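/- Let $d\ge 1$ be an integer and $\alpha>0$ a real number. For $V:\mathbb Z^d\to\mathbb R$ let $$\hat M(V)_{\vec n}:=\frac1{2d}\sum_{k=1}^d\bigl(V_{\vec n+\vec e_k}+V_{\vec n-\vec e_k}\bigr)\qquad(\vec n\in\mathbb Z^d),$$ where $\vec e_1,\dots,\vec e_d$ are the standard unit vectors. Given an initial function $a:\mathbb Z^d\to\mathbb R$ with $a\ge 0$ and $a\not\equiv 0$, consider the initial value problem $$f^{\tau+1}_{\vec n}=\frac{g^\tau_{\vec n}}{\{1-(g^\tau_{\vec n})^\alpha\}^{1/\alpha}},\qquad g^\tau_{\vec n}:=\hat M(f^\tau)_{\vec n}\qquad(\tau\in\mathbb Z_{\ge0},\ \vec n\in\mathbb Z^d),\qquad f^0_{\vec n}=a(\vec n).\tag{$*$}$$ A global solution of $(*)$ is a non-negative function $f:\mathbb Z_{\ge0}\times\mathbb Z^d\to\mathbb R$ that satisfies $(*)$ and $g^\tau_{\vec n}<1$ for all $\tau\in\mathbb Z_{\ge0}$ and $\vec n\in\mathbb Z^d$. **Theorem 2.1.** 1. If $0<\alpha<2/d$, then for every $a\ge0$ with $a\not\equiv0$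 there is no global solution of $(*)$. 2. If $\alpha=2/d$, then for every $a\ge0$ with $a\not\equiv0$ there is no global solution of $(*)$. 3. If $\alpha>2/d$, then there is an $\varepsilon>0$, depending only on $d$ and $\alpha$, such that for every $a\ge0$ with $a\not\equiv0$ and $\|a\|_1:=\sum_{\vec n\in\mathbb Z^d}|a(\vec n)|<\varepsilon$ the problem $(*)$ has a global solution, and this global solution is unique. -/

import Mathlib

namespace DiscreteHeat

/-- The nearest-neighbour average on the lattice `ℤ^d`. -/
noncomputable def avg {d : ℕ} (V : (Fin d → ℤ) → ℝ) (n : Fin d → ℤ) : ℝ :=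
  1 / (2 * (d : ℝ)) * ∑ k : Fin d, (V (n + Pi.single k 1) + V (n - Pi.single k 1))

/-- Admissible initial data: non-negative and not identically zero. -/
structure IsInitialDatum {d : ℕ} (a : (Fin d → ℤ) → ℝ) : Prop where
  nonneg : ∀ n, 0 ≤ a n
  ne_zero : ∃ n, a n ≠ 0

/-- `f` is a global (in time) solution of the discrete semilinear heat equation with exponent `α`
and initial datum `a`. The condition `avg (f τ) n < 1` at all times and sites says that every step
of the recursion is well defined (the base `1 - (avg (f τ) n) ^ α` is positive), hence that `f` is
determined by `a` for all times. -/
structure IsGlobalSolution {d : ℕ} (α : ℝ) (a : (Fin d → ℤ) → ℝ)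
    (f : ℕ → (Fin d → ℤ) → ℝ) : Prop where
  initial : ∀ n, f 0 n = a n
  nonneg : ∀ τ n, 0 ≤ f τ n
  avg_lt_one : ∀ τ n, avg (f τ) n < 1
  step : ∀ τ n, f (τ + 1) n = avg (f τ) n / (1 - avg (f τ) n ^ α) ^ (1 / α)

end DiscreteHeat

/-! One step averages and then applies `growth α 1`, the time-one map of `α u' = u ^ (1 + α)`. The
theorem compares this growth with the spreading of mass by averaging.

Nonexistence: the scalar flow is convex in its initial value, so by Jensen a global solution
dominates the flow started from the linear solution `avg^[k] a` (`growth_iterate_avg_le`). That flow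
must not blow up before time `k`, hence `avg^[k] a ≤ k ^ (-1/α)`. Diffusion, however, keeps half of
the mass of a ball of radius `r` in a cube of order `r ^ d` sites after `r ^ 2` steps
(`sum_le_two_mul_sum_box`). Together these bound the initial mass by a multiple of `r ^ (d - 2/α)`
(`sum_datum_le`). Below the critical exponent this tends to zero. At the critical exponent it bounds
the total mass at all times, while the nonlinearity adds at least `c / (t + 1)` to the mass at each
late step (`exists_le_sum_rpow`), and the harmonic series diverges.

Existence: Fourier analysis gives decay of order `t ^ (-d/2)` for the linear solution, so the `α`-th
powers of its suprema are summable when `α > 2/d`. For small data a slowly growing multiple of the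
linear solution is then a supersolution (`isGlobalSolution_evolution`). -/

open Finset Filter Topology MeasureTheory

namespace DiscreteHeat

variable {d : ℕ} {α : ℝ}

/-! ### The averaging operator -/

/-- The displacement to the nearest neighbours of a site. -/
def neighbour (d : ℕ) : Fin d ⊕ Fin d → (Fin d → ℤ) :=
  Sum.elim (fun k => Pi.single k 1) (fun k => -Pi.single k 1)

lemma avg_eq_sum (V : (Fin d → ℤ) → ℝ) (n : Fin d → ℤ) :
    avg V n = ∑ i, 1 / (2 * (d : ℝ)) * V (n + neighbour d i) := by
  simp [avg, neighbour, Fintype.sum_sum_type, mul_add, Finset.sum_add_distrib, Finset.mul_sum,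
    sub_eq_add_neg]

lemma sum_weights (hd : 1 ≤ d) : ∑ _i : Fin d ⊕ Fin d, 1 / (2 * (d : ℝ)) = 1 := by
  have : (d : ℝ) ≠ 0 := by positivity
  simp
  field_simp
  ring

lemma avg_mono {U V : (Fin d → ℤ) → ℝ} (h : ∀ n, U n ≤ V n) (n : Fin d → ℤ) :
    avg U n ≤ avg V n := by
  rw [avg_eq_sum, avg_eq_sum]
  gcongr
  exact h _

lemma avg_nonneg {V : (Fin d → ℤ) → ℝ} (h : ∀ n, 0 ≤ V n) (n : Fin d → ℤ) : 0 ≤ avg V n := by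
  rw [avg_eq_sum]
  exact Finset.sum_nonneg fun i _ => mul_nonneg (by positivity) (h _)

lemma avg_const_mul (c : ℝ) (V : (Fin d → ℤ) → ℝ) (n : Fin d → ℤ) :
    avg (fun m => c * V m) n = c * avg V n := by
  simp only [avg_eq_sum, Finset.mul_sum]
  exact Finset.sum_congr rfl fun _ _ => by ring

lemma iterate_avg_nonneg {V : (Fin d → ℤ) → ℝ} (h : ∀ n, 0 ≤ V n) (k : ℕ) (n : Fin d → ℤ) :
    0 ≤ avg^[k] V n := by
  induction k generalizing n with
  | zero => exact h n
  | succ k ih => rw [Function.iterate_succ_apply']; exact avg_nonneg ih n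

/-- Jensen for the uniform weights. Membership in `D` is recorded too, since the scalar flow is
convex only where it has not blown up. -/
lemma avg_mem_and_map_le (hd : 1 ≤ d) {D : Set ℝ} {φ : ℝ → ℝ} (hφ : ConvexOn ℝ D φ)
    {V : (Fin d → ℤ) → ℝ} (hV : ∀ n, V n ∈ D) (n : Fin d → ℤ) :
    avg V n ∈ D ∧ φ (avg V n) ≤ avg (fun m => φ (V m)) n := by
  have hw : ∀ i ∈ (Finset.univ : Finset (Fin d ⊕ Fin d)), 0 ≤ 1 / (2 * (d : ℝ)) :=
    fun _ _ => by positivity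
  rw [avg_eq_sum, avg_eq_sum]
  exact ⟨hφ.1.sum_mem hw (sum_weights hd) fun i _ => hV _,
    hφ.map_sum_le hw (sum_weights hd) fun i _ => hV _⟩

lemma summable_avg {V : (Fin d → ℤ) → ℝ} (hV : Summable V) : Summable (avg V) := by
  have : avg V = fun n => ∑ i, 1 / (2 * (d : ℝ)) * V (n + neighbour d i) :=
    funext (avg_eq_sum V)
  rw [this]
  exact summable_sum fun i _ =>
    (((Equiv.addRight (neighbour d i)).summable_iff (f := V)).2 hV).mul_left _

lemma tsum_avg (hd : 1 ≤ d) {V : (Fin d → ℤ) → ℝ} (hV : Summable V) :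
    ∑' n, avg V n = ∑' n, V n := by
  simp only [avg_eq_sum]
  have hs (i : Fin d ⊕ Fin d) : Summable fun n => V (n + neighbour d i) :=
    ((Equiv.addRight (neighbour d i)).summable_iff (f := V)).2 hV
  rw [Summable.tsum_finsetSum fun i _ => (hs i).mul_left _]
  have (i : Fin d ⊕ Fin d) :
      ∑' n, 1 / (2 * (d : ℝ)) * V (n + neighbour d i) = 1 / (2 * (d : ℝ)) * ∑' n, V n := by
    rw [tsum_mul_left, ← (Equiv.addRight (neighbour d i)).tsum_eq V]
    rfl
  simp only [this]
  rw [← Finset.sum_mul, sum_weights hd, one_mul]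

/-- The nearest-neighbour average is symmetric. -/
lemma tsum_mul_avg {ψ : (Fin d → ℤ) → ℝ} (hψ : ψ.support.Finite) (V : (Fin d → ℤ) → ℝ) :
    ∑' n, ψ n * avg V n = ∑' n, avg ψ n * V n := by
  have h1 (i : Fin d ⊕ Fin d) : Summable fun n => ψ n * V (n + neighbour d i) :=
    summable_of_hasFiniteSupport (hψ.subset (Function.support_mul_subset_left _ _))
  have h2 (i : Fin d ⊕ Fin d) : (fun n => ψ n * V (n + neighbour d i)) =
      (fun n => ψ (n + neighbour d i.swap) * V n) ∘ Equiv.addRight (neighbour d i) := by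
    funext n
    rcases i with i | i <;> simp [neighbour]
  have h3 (i : Fin d ⊕ Fin d) : Summable fun n => ψ (n + neighbour d i.swap) * V n := by
    rw [← (Equiv.addRight (neighbour d i)).summable_iff, ← h2]
    exact h1 i
  have h3' (i : Fin d ⊕ Fin d) : Summable fun n => ψ (n + neighbour d i) * V n := by
    simpa using h3 i.swap
  have h4 (i : Fin d ⊕ Fin d) : ∑' n, ψ n * V (n + neighbour d i) =
      ∑' n, ψ (n + neighbour d i.swap) * V n := by
    rw [h2]
    exact (Equiv.addRight (neighbour d i)).tsum_eq fun n => ψ (n + neighbour d i.swap) * V n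
  simp only [avg_eq_sum, Finset.mul_sum, Finset.sum_mul, mul_left_comm (ψ _), mul_assoc]
  rw [Summable.tsum_finsetSum fun i _ => (h1 i).mul_left _,
    Summable.tsum_finsetSum fun i _ => (h3' i).mul_left _]
  simp only [tsum_mul_left, h4]
  exact Fintype.sum_equiv (Equiv.sumComm _ _) _ _ fun i => rfl

/-! ### Diffusive spreading of mass -/

/-- The squared Euclidean length of a lattice point. -/
def normSq (m : Fin d → ℤ) : ℝ := ∑ j, (m j : ℝ) ^ 2

lemma normSq_add_sub (m : Fin d → ℤ) (k : Fin d) :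
    normSq (m + Pi.single k 1) + normSq (m - Pi.single k 1) = 2 * normSq m + 2 := by
  have h (j : Fin d) : ((m j : ℝ) + ((Pi.single k 1 : Fin d → ℤ) j : ℝ)) ^ 2 +
      ((m j : ℝ) - ((Pi.single k 1 : Fin d → ℤ) j : ℝ)) ^ 2 = 2 * (m j : ℝ) ^ 2 + if j = k then 2 else 0 := by
    by_cases hj : j = k
    · subst hj
      simp
      ring
    · simp [hj]
      ring
  simp only [normSq, Pi.add_apply, Pi.sub_apply, Int.cast_add, Int.cast_sub,
    ← Finset.sum_add_distrib, h, Finset.mul_sum]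
  rw [Finset.sum_add_distrib]
  simp

/-- A concave quadratic cut off at zero, a subsolution of the discrete heat equation. -/
noncomputable def bump (c : ℝ) (m : Fin d → ℤ) : ℝ := max 0 (c - normSq m)

lemma bump_nonneg (c : ℝ) (m : Fin d → ℤ) : 0 ≤ bump c m := le_max_left _ _

/-- Averaging raises `normSq` by exactly one, so the quadratic loses one unit of height; positivity
and monotonicity of `avg` take care of the cut-off. -/
lemma bump_sub_one_le_avg (hd : 1 ≤ d) (c : ℝ) (m : Fin d → ℤ) :
    bump (c - 1) m ≤ avg (bump c) m := by
  refine max_le (avg_nonneg (bump_nonneg c) m) ?_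
  have hd' : (d : ℝ) ≠ 0 := by positivity
  have h : avg (fun m => c - normSq m) m = c - 1 - normSq m := by
    have (k : Fin d) : (c - normSq (m + Pi.single k 1)) + (c - normSq (m - Pi.single k 1)) =
        2 * (c - 1 - normSq m) := by linarith [normSq_add_sub m k]
    simp only [avg, this]
    simp
    field_simp
  rw [← h]
  exact avg_mono (fun n => le_max_right _ _) m

/-- The lattice cube of side `2 r + 1` centred at the origin. -/
noncomputable def box (d r : ℕ) : Finset (Fin d → ℤ) :=
  Fintype.piFinset fun _ => Finset.Icc (-(r : ℤ)) r

lemma card_box (r : ℕ) : (box d r).card = (2 * r + 1) ^ d := by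
  simp only [box, Fintype.card_piFinset, Int.card_Icc, Finset.prod_const, Finset.card_univ,
    Fintype.card_fin]
  congr 1
  omega

lemma mem_box_of_normSq_le {r : ℕ} {m : Fin d → ℤ} (h : normSq m ≤ (r : ℝ) ^ 2) : m ∈ box d r := by
  simp only [box, Fintype.mem_piFinset, Finset.mem_Icc]
  intro j
  have h1 : (m j : ℝ) ^ 2 ≤ (r : ℝ) ^ 2 :=
    (Finset.single_le_sum (f := fun j => (m j : ℝ) ^ 2) (fun i _ => sq_nonneg _)
      (Finset.mem_univ j)).trans h
  have h2 := abs_le.1 (abs_le_of_sq_le_sq h1 (by positivity))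
  exact ⟨by exact_mod_cast h2.1, by exact_mod_cast h2.2⟩

lemma bump_eq_zero {c : ℝ} {r : ℕ} (hc : c ≤ (r : ℝ) ^ 2) {m : Fin d → ℤ} (hm : m ∉ box d r) :
    bump c m = 0 := by
  refine max_eq_left ?_
  by_contra! h
  exact hm (mem_box_of_normSq_le (by linarith))

lemma finite_support_bump (c : ℝ) : (bump (d := d) c).support.Finite := by
  obtain ⟨r, hr⟩ := exists_nat_ge |c|
  refine (box d (r + 1)).finite_toSet.subset fun m hm => ?_
  by_contra h
  refine hm (bump_eq_zero (r := r + 1) ?_ h)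
  push_cast
  nlinarith [le_abs_self c, abs_nonneg c]

/-- By symmetry each average moves from `V` onto the bump, at the cost of one unit of height. -/
lemma tsum_bump_mul_le (hd : 1 ≤ d) {V : (Fin d → ℤ) → ℝ} (hV : ∀ n, 0 ≤ V n) (c : ℝ) (k : ℕ) :
    ∑' n, bump (c - k) n * V n ≤ ∑' n, bump c n * avg^[k] V n := by
  induction k generalizing c with
  | zero => simp
  | succ k ih =>
    have hs (c : ℝ) {W : (Fin d → ℤ) → ℝ} : Summable fun n => bump c n * W n :=
      summable_of_hasFiniteSupport
        ((finite_support_bump c).subset (Function.support_mul_subset_left _ _))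
    calc ∑' n, bump (c - (k + 1 : ℕ)) n * V n = ∑' n, bump (c - 1 - k) n * V n := by
          push_cast; ring_nf
      _ ≤ ∑' n, bump (c - 1) n * avg^[k] V n := ih (c - 1)
      _ ≤ ∑' n, avg (bump c) n * avg^[k] V n := by
          refine (hs _).tsum_le_tsum (fun n => ?_) ?_
          · exact mul_le_mul_of_nonneg_right (bump_sub_one_le_avg hd c n)
              (iterate_avg_nonneg hV k n)
          · have h : (avg (bump (d := d) c)).support.Finite := by
              have : (avg (bump (d := d) c)).support ⊆ ⋃ i,
                  (fun n => n + neighbour d i) ⁻¹' (bump (d := d) c).support := by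
                intro n hn
                by_contra h
                simp only [Set.mem_iUnion, Set.mem_preimage, Function.mem_support, not_exists,
                  not_not] at h
                exact hn (by simp [avg_eq_sum, h])
              exact (Set.finite_iUnion fun i => (finite_support_bump c).preimage
                (add_left_injective _).injOn).subset this
            exact summable_of_hasFiniteSupport (h.subset (Function.support_mul_subset_left _ _))
      _ = ∑' n, bump c n * avg^[k + 1] V n := by
          rw [← tsum_mul_avg (finite_support_bump c), Function.iterate_succ_apply']

/-- After at most `r ^ 2` steps, at least half of the mass that was initially in the ball of
radius `r` is in the cube of radius `2 r`. -/
lemma sum_le_two_mul_sum_box (hd : 1 ≤ d) {V : (Fin d → ℤ) → ℝ} (hV : ∀ n, 0 ≤ V n) {r k : ℕ}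
    (hr : 1 ≤ r) (hk : k ≤ r ^ 2) {s : Finset (Fin d → ℤ)} (hs : ∀ m ∈ s, normSq m ≤ (r : ℝ) ^ 2) :
    ∑ m ∈ s, V m ≤ 2 * ∑ n ∈ box d (2 * r), avg^[k] V n := by
  have hr' : (0 : ℝ) < (r : ℝ) ^ 2 := by positivity
  have hk' : (k : ℝ) ≤ (r : ℝ) ^ 2 := by exact_mod_cast hk
  have hsum : Summable fun n => bump (4 * (r : ℝ) ^ 2 - k) n * V n :=
    summable_of_hasFiniteSupport
      ((finite_support_bump _).subset (Function.support_mul_subset_left _ _))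
  -- Of the height `4 r ^ 2`, time takes at most `r ^ 2` and the distance from the origin at most `r
  -- ^ 2`, which leaves half.
  have h1 : 2 * (r : ℝ) ^ 2 * ∑ m ∈ s, V m ≤ ∑' n, bump (4 * (r : ℝ) ^ 2 - k) n * V n := by
    rw [Finset.mul_sum]
    refine le_trans (Finset.sum_le_sum fun m hm => ?_)
      (hsum.sum_le_tsum s fun n _ => mul_nonneg (bump_nonneg _ _) (hV n))
    refine mul_le_mul_of_nonneg_right (le_trans ?_ (le_max_right _ _)) (hV m)
    linarith [hs m hm]
  have h2 : ∑' n, bump (4 * (r : ℝ) ^ 2) n * avg^[k] V n ≤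
      4 * (r : ℝ) ^ 2 * ∑ n ∈ box d (2 * r), avg^[k] V n := by
    rw [tsum_eq_sum (s := box d (2 * r)), Finset.mul_sum]
    · refine Finset.sum_le_sum fun n _ => mul_le_mul_of_nonneg_right ?_ (iterate_avg_nonneg hV k n)
      refine max_le (by positivity) ?_
      have : 0 ≤ normSq n := Finset.sum_nonneg fun _ _ => sq_nonneg _
      linarith
    · intro n hn
      rw [bump_eq_zero _ hn, zero_mul]
      push_cast
      linarith
  have h3 := tsum_bump_mul_le hd hV (4 * (r : ℝ) ^ 2) k
  have h4 : (2 * (r : ℝ) ^ 2) * ∑ m ∈ s, V m ≤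
      (2 * (r : ℝ) ^ 2) * (2 * ∑ n ∈ box d (2 * r), avg^[k] V n) := by linarith
  exact le_of_mul_le_mul_left h4 (by positivity)

lemma card_box_le (d : ℕ) {r : ℕ} (hr : 1 ≤ r) :
    ((box d (2 * r)).card : ℝ) ≤ 5 ^ d * (r : ℝ) ^ d := by
  rw [card_box, ← mul_pow]
  have : (1 : ℝ) ≤ r := by exact_mod_cast hr
  push_cast
  gcongr
  linarith

lemma exists_radius (s : Finset (Fin d → ℤ)) :
    ∃ r₀ : ℕ, 1 ≤ r₀ ∧ ∀ r : ℕ, r₀ ≤ r → ∀ m ∈ s, normSq m ≤ (r : ℝ) ^ 2 := by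
  obtain ⟨r₀, h⟩ := exists_nat_ge (∑ m ∈ s, normSq m)
  refine ⟨r₀ + 1, by omega, fun r hr m hm => ?_⟩
  have h0 (m : Fin d → ℤ) : 0 ≤ normSq m := Finset.sum_nonneg fun _ _ => sq_nonneg _
  have h1 := Finset.single_le_sum (f := normSq) (fun m _ => h0 m) hm
  have h2 : (r₀ : ℝ) + 1 ≤ r := by exact_mod_cast hr
  nlinarith [h0 m]

lemma exists_le_sum_rpow (hd : 1 ≤ d) (hα : 0 < α) {a : (Fin d → ℤ) → ℝ} (ha : IsInitialDatum a) (h : α = 2 / d) :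
    ∃ c : ℝ, 0 < c ∧ ∃ T : ℕ, ∀ t : ℕ, T ≤ t → ∃ s : Finset (Fin d → ℤ),
      c / (t + 1) ≤ ∑ n ∈ s, avg^[t + 1] a n ^ (1 + α) := by
  obtain ⟨n, hn⟩ := ha.ne_zero
  have hpos := lt_of_le_of_ne (ha.nonneg n) hn.symm
  obtain ⟨r₀, hr₀, hr⟩ := exists_radius {n}
  have hd' : (0 : ℝ) < d := by exact_mod_cast hd
  refine ⟨(a n / 2) ^ (1 + α) / 100, by positivity, r₀ ^ 2, fun t ht => ?_⟩
  -- The diffusive radius: the cube has of order `t ^ (d / 2)` sites. In the power-mean inequality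
  -- this count enters to the power `α = 2 / d`, giving the factor of order `t`.
  set r := Nat.sqrt (t + 1) + 1 with hrdef
  have hr1 : 1 ≤ r := by omega
  have hr2 : t + 1 ≤ r ^ 2 := by
    rw [pow_two]
    exact (Nat.lt_succ_sqrt (t + 1)).le
  have hr3 : r ^ 2 ≤ 4 * (t + 1) := by
    have h1 := Nat.sqrt_le (t + 1)
    have h2 : 1 ≤ Nat.sqrt (t + 1) := Nat.le_sqrt.2 (by omega)
    rw [hrdef]
    nlinarith
  have hr4 : r₀ ≤ r := by
    by_contra! hlt
    nlinarith
  refine ⟨box d (2 * r), ?_⟩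
  have h1 : a n / 2 ≤ ∑ m ∈ box d (2 * r), avg^[t + 1] a m := by
    have := sum_le_two_mul_sum_box hd ha.nonneg hr1 hr2 (hr r hr4)
    rw [Finset.sum_singleton] at this
    linarith
  have h2 := Real.rpow_sum_le_const_mul_sum_rpow_of_nonneg (box d (2 * r))
    (f := avg^[t + 1] a) (p := 1 + α) (by linarith) fun i _ => iterate_avg_nonneg ha.nonneg _ i
  have h3 : ((box d (2 * r)).card : ℝ) ^ (1 + α - 1) ≤ 100 * (t + 1) := by
    calc ((box d (2 * r)).card : ℝ) ^ (1 + α - 1) ≤ ((5 * (r : ℝ)) ^ d) ^ (1 + α - 1) := by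
          refine Real.rpow_le_rpow (by positivity) ?_ (by linarith)
          rw [mul_pow]
          exact card_box_le d hr1
      _ = 25 * (r : ℝ) ^ 2 := by
          rw [← Real.rpow_natCast, ← Real.rpow_mul (by positivity), h,
            show (d : ℝ) * (1 + 2 / d - 1) = (2 : ℕ) by push_cast; field_simp; ring,
            Real.rpow_natCast]
          ring
      _ ≤ 100 * (t + 1) := by
          have : (r : ℝ) ^ 2 ≤ 4 * (t + 1) := by exact_mod_cast hr3
          linarith
  have h4 : 0 ≤ ∑ m ∈ box d (2 * r), avg^[t + 1] a m ^ (1 + α) :=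
    Finset.sum_nonneg fun i _ => Real.rpow_nonneg (iterate_avg_nonneg ha.nonneg _ i) _
  have h5 : (a n / 2) ^ (1 + α) ≤
      100 * (t + 1) * ∑ m ∈ box d (2 * r), avg^[t + 1] a m ^ (1 + α) := by
    refine (Real.rpow_le_rpow (by positivity) h1 (by linarith)).trans (h2.trans ?_)
    gcongr
  rw [div_div, div_le_iff₀ (by positivity)]
  linarith

/-! ### The scalar flow and its convexity -/

/-- The flow at time `k` of the ordinary differential equation `α u' = u ^ (1 + α)`. -/
noncomputable def growth (α k u : ℝ) : ℝ := u / (1 - k * u ^ α) ^ (1 / α)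

/-- The initial values for which `growth α k` has not blown up. -/
def growthDomain (α k : ℝ) : Set ℝ := {u | 0 ≤ u ∧ k * u ^ α < 1}

lemma convex_growthDomain (hα : 0 < α) {k : ℝ} (hk : 0 ≤ k) : Convex ℝ (growthDomain α k) := by
  refine Set.OrdConnected.convex ⟨fun x hx y hy z hz => ⟨hx.1.trans hz.1, ?_⟩⟩
  refine lt_of_le_of_lt ?_ hy.2
  have := hx.1.trans hz.1
  gcongr
  exact hz.2

lemma growth_eq_mul {k u : ℝ} (hu : u ∈ growthDomain α k) :
    growth α k u = u * (1 - k * u ^ α) ^ (-(1 / α)) := by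
  rw [Real.rpow_neg (by linarith [hu.2]), growth, div_eq_mul_inv]

lemma growth_nonneg {k u : ℝ} (hu : u ∈ growthDomain α k) : 0 ≤ growth α k u :=
  div_nonneg hu.1 (Real.rpow_nonneg (by linarith [hu.2]) _)

lemma continuousOn_growth (hα : 0 < α) (k : ℝ) :
    ContinuousOn (growth α k) (growthDomain α k) := by
  have h : ContinuousOn (fun u : ℝ => 1 - k * u ^ α) (growthDomain α k) :=
    continuousOn_const.sub
      (continuousOn_const.mul (continuousOn_id.rpow_const fun x _ => Or.inr hα.le))
  exact continuousOn_id.div (h.rpow_const fun x hx => Or.inl (by linarith [hx.2]))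
    fun x hx => (Real.rpow_pos_of_pos (by linarith [hx.2]) _).ne'

lemma hasDerivAt_growth (hα : 0 < α) {k u : ℝ} (hu : u ∈ growthDomain α k) (hu0 : 0 < u)
    (hn : growthDomain α k ∈ 𝓝 u) :
    HasDerivAt (growth α k) ((1 - k * u ^ α) ^ (-(1 / α) - 1)) u := by
  have hpos : 0 < 1 - k * u ^ α := by linarith [hu.2]
  have h1 : HasDerivAt (fun u : ℝ => 1 - k * u ^ α) (-(k * (α * u ^ (α - 1)))) u :=
    ((Real.hasDerivAt_rpow_const (Or.inl hu0.ne')).const_mul k).const_sub 1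
  have h2 := (hasDerivAt_id u).mul (h1.rpow_const (p := -(1 / α)) (Or.inl hpos.ne'))
  refine (h2.congr_deriv ?_).congr_of_eventuallyEq ?_
  · have e1 : (1 - k * u ^ α) ^ (-(1 / α)) =
        (1 - k * u ^ α) ^ (-(1 / α) - 1) * (1 - k * u ^ α) := by
      rw [← Real.rpow_add_one hpos.ne']
      ring_nf
    have e2 : u ^ α = u ^ (α - 1) * u := by
      rw [← Real.rpow_add_one hu0.ne']
      ring_nf
    rw [e1]
    generalize (1 - k * u ^ α) ^ (-(1 / α) - 1) = w
    rw [e2]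
    simp only [id]
    field_simp
    ring
  · filter_upwards [hn] with v hv
    exact growth_eq_mul hv

/-- The derivative is a negative power of `1 - k * u ^ α`, a nonincreasing function of `u`. Only
interior points matter, which avoids differentiating `u ^ α` at zero. -/
lemma convexOn_growth (hα : 0 < α) {k : ℝ} (hk : 0 ≤ k) :
    ConvexOn ℝ (growthDomain α k) (growth α k) := by
  have hint {u : ℝ} (hu : u ∈ interior (growthDomain α k)) : 0 < u := by
    have : u ∈ interior (Set.Ici (0 : ℝ)) := interior_mono (fun v hv => hv.1) hu
    simpa using this
  have hder {u : ℝ} (hu : u ∈ interior (growthDomain α k)) :=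
    hasDerivAt_growth hα (interior_subset hu) (hint hu) (mem_interior_iff_mem_nhds.1 hu)
  refine MonotoneOn.convexOn_of_deriv (convex_growthDomain hα hk) (continuousOn_growth hα k)
    (fun u hu => (hder hu).differentiableAt.differentiableWithinAt) fun u hu v hv huv => ?_
  rw [(hder hu).deriv, (hder hv).deriv]
  refine Real.rpow_le_rpow_of_nonpos (by linarith [(interior_subset hv).2]) ?_ ?_
  · have := hint hu
    gcongr
  · have : 0 < 1 / α := by positivity
    linarith

lemma growth_mono (hα : 0 < α) {k u v : ℝ} (hk : 0 ≤ k) (hu : 0 ≤ u)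
    (hv : v ∈ growthDomain α k) (huv : u ≤ v) : growth α k u ≤ growth α k v := by
  have h := hv.2
  have : 0 < 1 - k * v ^ α := by linarith
  unfold growth
  gcongr
  exact hv.1

lemma growth_rpow (hα : 0 < α) {k u : ℝ} (hu : u ∈ growthDomain α k) :
    growth α k u ^ α = u ^ α / (1 - k * u ^ α) := by
  have h : 0 ≤ 1 - k * u ^ α := by linarith [hu.2]
  rw [growth, Real.div_rpow hu.1 (Real.rpow_nonneg h _), ← Real.rpow_mul h,
    one_div_mul_cancel hα.ne', Real.rpow_one]

/-- The flow property. -/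
lemma growth_one_growth (hα : 0 < α) {k u : ℝ} (hu : u ∈ growthDomain α k)
    (h : growth α k u < 1) :
    u ∈ growthDomain α (k + 1) ∧ growth α 1 (growth α k u) = growth α (k + 1) u := by
  have hpos : 0 < 1 - k * u ^ α := by linarith [hu.2]
  have hlt : u ^ α / (1 - k * u ^ α) < 1 := by
    rw [← growth_rpow hα hu]
    exact Real.rpow_lt_one (growth_nonneg hu) h hα
  rw [div_lt_one hpos] at hlt
  refine ⟨⟨hu.1, by linarith⟩, ?_⟩
  have e : 1 - (k + 1) * u ^ α = (1 - k * u ^ α) * (1 - 1 * (u ^ α / (1 - k * u ^ α))) := by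
    field_simp
    ring
  have hpos' : 0 ≤ 1 - 1 * (u ^ α / (1 - k * u ^ α)) := by
    rw [one_mul, sub_nonneg, div_le_one hpos]
    exact hlt.le
  rw [growth, growth_rpow hα hu, growth, growth, e, Real.mul_rpow hpos.le hpos', div_div]

/-- Follows from `1 - x ≤ exp (-x)` and `1 + y ≤ exp y` with `x = u ^ α`, `y = x / α`. It measures
the mass gained in one step. -/
lemma add_rpow_le_growth_one (hα : 0 < α) {u : ℝ} (hu0 : 0 ≤ u) (hu1 : u < 1) :
    u + 1 / α * u ^ (1 + α) ≤ growth α 1 u := by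
  have hlt : u ^ α < 1 := Real.rpow_lt_one hu0 hu1 hα
  have hpos : 0 < 1 - 1 * u ^ α := by linarith
  have h1 : (1 - 1 * u ^ α) ^ (1 / α) ≤ Real.exp (-(u ^ α / α)) := by
    have := Real.rpow_le_rpow hpos.le (Real.one_sub_le_exp_neg (1 * u ^ α)) (z := 1 / α)
      (by positivity)
    rwa [← Real.exp_mul, show -(1 * u ^ α) * (1 / α) = -(u ^ α / α) by ring] at this
  have h2 : (1 + u ^ α / α) * (1 - 1 * u ^ α) ^ (1 / α) ≤ 1 := by
    have h0 : 0 ≤ u ^ α := Real.rpow_nonneg hu0 _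
    calc (1 + u ^ α / α) * (1 - 1 * u ^ α) ^ (1 / α)
        ≤ Real.exp (u ^ α / α) * Real.exp (-(u ^ α / α)) := by
          gcongr
          linarith [Real.add_one_le_exp (u ^ α / α)]
      _ = 1 := by rw [← Real.exp_add, add_neg_cancel, Real.exp_zero]
  have h3 : u + 1 / α * u ^ (1 + α) = u * (1 + u ^ α / α) := by
    rw [Real.rpow_add' hu0 (by linarith), Real.rpow_one]
    ring
  rw [h3, growth, le_div_iff₀ (Real.rpow_pos_of_pos hpos _), mul_assoc]
  exact mul_le_of_le_one_right hu0 h2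

/-! ### Nonexistence up to the critical exponent -/

namespace IsGlobalSolution

variable {a : (Fin d → ℤ) → ℝ} {f : ℕ → (Fin d → ℤ) → ℝ}

lemma shift (hf : IsGlobalSolution α a f) (s : ℕ) :
    IsGlobalSolution α (f s) (fun τ => f (s + τ)) :=
  ⟨fun _ => rfl, fun _ => hf.nonneg _, fun _ => hf.avg_lt_one _, fun _ => hf.step _⟩

lemma step_eq_growth (hf : IsGlobalSolution α a f) (τ : ℕ) (n : Fin d → ℤ) :
    f (τ + 1) n = growth α 1 (avg (f τ) n) := by
  rw [hf.step, growth, one_mul]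

lemma mem_growthDomain_one (hα : 0 < α) (hf : IsGlobalSolution α a f) (τ : ℕ) (n : Fin d → ℤ) :
    avg (f τ) n ∈ growthDomain α 1 := by
  refine ⟨avg_nonneg (hf.nonneg τ) n, ?_⟩
  rw [one_mul]
  exact Real.rpow_lt_one (avg_nonneg (hf.nonneg τ) n) (hf.avg_lt_one τ n) hα

lemma avg_add_le (hα : 0 < α) (hf : IsGlobalSolution α a f) (τ : ℕ) (n : Fin d → ℤ) :
    avg (f τ) n + 1 / α * avg (f τ) n ^ (1 + α) ≤ f (τ + 1) n := by
  rw [hf.step_eq_growth]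
  exact add_rpow_le_growth_one hα (avg_nonneg (hf.nonneg τ) n) (hf.avg_lt_one τ n)

lemma iterate_avg_le (hα : 0 < α) (hf : IsGlobalSolution α a f) (k : ℕ) (n : Fin d → ℤ) :
    avg^[k] a n ≤ f k n := by
  induction k generalizing n with
  | zero => exact (hf.initial n).ge
  | succ k ih =>
    rw [Function.iterate_succ_apply']
    refine (avg_mono ih n).trans (le_trans ?_ (hf.avg_add_le hα k n))
    have := Real.rpow_nonneg (avg_nonneg (hf.nonneg k) n) (1 + α)
    exact le_add_of_nonneg_right (by positivity)

/-- A global solution dominates the spatially homogeneous flow of the averaged initial datum,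
which therefore does not blow up. -/
lemma growth_iterate_avg_le (hd : 1 ≤ d) (hα : 0 < α) (hf : IsGlobalSolution α a f) (k : ℕ)
    (n : Fin d → ℤ) :
    avg^[k] a n ∈ growthDomain α k ∧ growth α k (avg^[k] a n) ≤ f k n := by
  induction k generalizing n with
  | zero =>
    have := hf.nonneg 0 n
    rw [hf.initial] at this
    simp [growthDomain, growth, hf.initial, this]
  | succ k ih =>
    rw [Function.iterate_succ_apply', Nat.cast_succ]
    -- Jensen: flowing the average for time `k` gives at most the average of the flows.
    obtain ⟨h1, h2⟩ := avg_mem_and_map_le hd (convexOn_growth hα k.cast_nonneg)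
      (fun m => (ih m).1) n
    have h3 := h2.trans (avg_mono (fun m => (ih m).2) n)
    obtain ⟨h4, h5⟩ := growth_one_growth hα h1 (h3.trans_lt (hf.avg_lt_one k n))
    refine ⟨h4, ?_⟩
    rw [← h5, hf.step_eq_growth]
    exact growth_mono hα zero_le_one (growth_nonneg h1) (hf.mem_growthDomain_one hα k n) h3

lemma iterate_avg_le_rpow (hd : 1 ≤ d) (hα : 0 < α) (hf : IsGlobalSolution α a f) {k : ℕ}
    (hk : 1 ≤ k) (n : Fin d → ℤ) : avg^[k] a n ≤ (k : ℝ) ^ (-(1 / α)) := by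
  obtain ⟨h0, h1⟩ := (hf.growth_iterate_avg_le hd hα k n).1
  have hk' : (0 : ℝ) < k := by exact_mod_cast hk
  have h2 : avg^[k] a n ^ α ≤ (k : ℝ)⁻¹ := by
    rw [← one_div, le_div_iff₀ hk']
    linarith
  have h3 := Real.rpow_le_rpow (Real.rpow_nonneg h0 α) h2 (z := 1 / α) (by positivity)
  rwa [← Real.rpow_mul h0, mul_one_div_cancel hα.ne', Real.rpow_one, Real.inv_rpow hk'.le,
    ← Real.rpow_neg hk'.le] at h3

lemma datum_nonneg (hf : IsGlobalSolution α a f) (n : Fin d → ℤ) : 0 ≤ a n :=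
  hf.initial n ▸ hf.nonneg 0 n

lemma sum_datum_le (hd : 1 ≤ d) (hα : 0 < α) (hf : IsGlobalSolution α a f) {r : ℕ} (hr : 1 ≤ r)
    {s : Finset (Fin d → ℤ)} (hs : ∀ m ∈ s, normSq m ≤ (r : ℝ) ^ 2) :
    ∑ m ∈ s, a m ≤ 2 * 5 ^ d * (r : ℝ) ^ (d - 2 / α) := by
  have hr' : (0 : ℝ) < r := by exact_mod_cast hr
  have h1 := sum_le_two_mul_sum_box hd hf.datum_nonneg hr le_rfl hs
  have h2 : ∑ n ∈ box d (2 * r), avg^[r ^ 2] a n ≤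
      (box d (2 * r)).card * (r : ℝ) ^ (-(2 / α)) := by
    rw [← nsmul_eq_mul]
    refine Finset.sum_le_card_nsmul _ _ _ fun n _ => ?_
    refine (hf.iterate_avg_le_rpow hd hα (Nat.one_le_pow _ _ hr) n).trans_eq ?_
    push_cast
    rw [← Real.rpow_natCast, ← Real.rpow_mul hr'.le]
    push_cast
    ring_nf
  calc ∑ m ∈ s, a m ≤ 2 * (5 ^ d * (r : ℝ) ^ d * (r : ℝ) ^ (-(2 / α))) := by
        refine h1.trans ?_
        gcongr
        refine h2.trans ?_
        gcongr
        exact card_box_le d hr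
    _ = 2 * 5 ^ d * (r : ℝ) ^ (d - 2 / α) := by
        rw [sub_eq_add_neg, Real.rpow_add hr', Real.rpow_natCast]
        ring

theorem false_of_subcritical (hd : 1 ≤ d) (hα : 0 < α) (hf : IsGlobalSolution α a f)
    (ha : IsInitialDatum a) (h : α < 2 / d) : False := by
  obtain ⟨n, hn⟩ := ha.ne_zero
  have hpos := lt_of_le_of_ne (ha.nonneg n) hn.symm
  obtain ⟨r₀, hr₀, hr⟩ := exists_radius {n}
  have hd' : (0 : ℝ) < d := by exact_mod_cast hd
  have hexp : 0 < -((d : ℝ) - 2 / α) := by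
    rw [lt_div_iff₀ hd'] at h
    rw [neg_sub, sub_pos, lt_div_iff₀ hα]
    linarith
  have hlim : Tendsto (fun r : ℕ => 2 * 5 ^ d * (r : ℝ) ^ ((d : ℝ) - 2 / α)) atTop (𝓝 0) := by
    have := (tendsto_rpow_neg_atTop hexp).comp (tendsto_natCast_atTop_atTop (R := ℝ))
    simpa using this.const_mul (2 * 5 ^ d : ℝ)
  refine absurd (ge_of_tendsto hlim ?_) (not_le.2 hpos)
  filter_upwards [eventually_ge_atTop r₀] with r h
  simpa using hf.sum_datum_le hd hα (hr₀.trans h) (hr r h)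

lemma sum_le_of_critical (hd : 1 ≤ d) (hα : 0 < α) (hf : IsGlobalSolution α a f)
    (h : α = 2 / d) (s : Finset (Fin d → ℤ)) : ∑ m ∈ s, a m ≤ 2 * 5 ^ d := by
  obtain ⟨r₀, hr₀, hr⟩ := exists_radius s
  have hd' : (0 : ℝ) < d := by exact_mod_cast hd
  have hexp : (d : ℝ) - 2 / α = 0 := by
    rw [h]
    field_simp
    ring
  simpa [hexp] using hf.sum_datum_le hd hα hr₀ (hr r₀ le_rfl)

theorem false_of_critical (hd : 1 ≤ d) (hα : 0 < α) (hf : IsGlobalSolution α a f)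
    (ha : IsInitialDatum a) (h : α = 2 / d) : False := by
  have hsum (t : ℕ) : Summable (f t) :=
    summable_of_sum_le (hf.nonneg t) ((hf.shift t).sum_le_of_critical hd hα h)
  have hbound (t : ℕ) : ∑' n, f t n ≤ 2 * 5 ^ d :=
    (hsum t).tsum_le_of_sum_le ((hf.shift t).sum_le_of_critical hd hα h)
  obtain ⟨c, hc, T, hT⟩ := exists_le_sum_rpow hd hα ha h
  -- Averaging conserves the total mass, so any increase is due to the nonlinearity, which is
  -- bounded below through the linear solution.
  have hstep (t : ℕ) (ht : T ≤ t) :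
      ∑' n, f t n + c / α * (1 / ((t : ℝ) + 1)) ≤ ∑' n, f (t + 1) n := by
    obtain ⟨s, hs⟩ := hT t ht
    rw [← tsum_avg hd (hsum t)]
    have hdiff := (hsum (t + 1)).sub (summable_avg (hsum t))
    have h1 (n : Fin d → ℤ) : 1 / α * avg^[t + 1] a n ^ (1 + α) ≤ f (t + 1) n - avg (f t) n := by
      refine le_trans ?_ (le_sub_iff_add_le'.2 (hf.avg_add_le hα t n))
      have h0 := iterate_avg_nonneg ha.nonneg (t + 1) n
      have hle : avg^[t + 1] a n ≤ avg (f t) n := by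
        rw [Function.iterate_succ_apply']
        exact avg_mono (hf.iterate_avg_le hα t) n
      gcongr
    have h2 : ∑ n ∈ s, 1 / α * avg^[t + 1] a n ^ (1 + α) ≤
        ∑' n, (f (t + 1) n - avg (f t) n) := by
      refine (Finset.sum_le_sum fun n _ => h1 n).trans (hdiff.sum_le_tsum s fun n _ => ?_)
      refine le_trans ?_ (h1 n)
      exact mul_nonneg (by positivity)
        (Real.rpow_nonneg (iterate_avg_nonneg ha.nonneg (t + 1) n) _)
    rw [(hsum (t + 1)).tsum_sub (summable_avg (hsum t)), ← Finset.mul_sum] at h2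
    have h3 : c / α * (1 / ((t : ℝ) + 1)) ≤
        1 / α * ∑ n ∈ s, avg^[t + 1] a n ^ (1 + α) := by
      rw [show c / α * (1 / ((t : ℝ) + 1)) = 1 / α * (c / (t + 1)) by ring]
      gcongr
    linarith
  have hgrow (k : ℕ) : ∑ j ∈ Finset.range k, c / α * (1 / (((j + T : ℕ) : ℝ) + 1)) ≤
      ∑' n, f (k + T) n := by
    induction k with
    | zero => simpa using tsum_nonneg (hf.nonneg T)
    | succ k ih =>
      rw [Finset.sum_range_succ, Nat.add_right_comm]
      have := hstep (k + T) (by omega)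
      linarith
  have hsummable : Summable fun j : ℕ => c / α * (1 / (((j + T : ℕ) : ℝ) + 1)) :=
    summable_of_sum_range_le (fun j => by positivity) fun k => (hgrow k).trans (hbound _)
  rw [summable_mul_left_iff (by positivity), summable_nat_add_iff T
    (f := fun j : ℕ => 1 / ((j : ℝ) + 1))] at hsummable
  refine Real.not_summable_one_div_natCast ((summable_nat_add_iff 1).1 ?_)
  simpa using hsummable

end IsGlobalSolution

/-! ### Decay of the linear solution by Fourier analysis -/

/-- Lebesgue measure on the torus `(-π, π] ^ d`. -/
noncomputable def torusMeasure (d : ℕ) : Measure (Fin d → ℝ) :=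
  Measure.pi fun _ => volume.restrict (Set.Ioc (-Real.pi) Real.pi)

instance isFiniteMeasure_torusMeasure : IsFiniteMeasure (torusMeasure d) := by
  unfold torusMeasure
  infer_instance

/-- The Fourier multiplier of the nearest-neighbour average. -/
noncomputable def symbol (θ : Fin d → ℝ) : ℝ := 1 / (d : ℝ) * ∑ k, Real.cos (θ k)

/-- The transition probabilities of the simple random walk, as Fourier integrals. -/
noncomputable def kernel (t : ℕ) (n : Fin d → ℤ) : ℝ :=
  ((2 * Real.pi) ^ d)⁻¹ * ∫ θ, symbol θ ^ t * ∏ j, Real.cos (n j * θ j) ∂torusMeasure d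

lemma prod_cos_add_sub (n : Fin d → ℤ) (k : Fin d) (θ : Fin d → ℝ) :
    ∏ j, Real.cos ((n + Pi.single k 1 : Fin d → ℤ) j * θ j) +
      ∏ j, Real.cos ((n - Pi.single k 1 : Fin d → ℤ) j * θ j) =
    2 * Real.cos (θ k) * ∏ j, Real.cos (n j * θ j) := by
  have hne {j : Fin d} (hj : j ∈ Finset.univ.erase k) : j ≠ k := Finset.ne_of_mem_erase hj
  rw [← Finset.mul_prod_erase _ _ (Finset.mem_univ k), ← Finset.mul_prod_erase _ _
    (Finset.mem_univ k), ← Finset.mul_prod_erase _ (fun j => Real.cos (n j * θ j))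
    (Finset.mem_univ k)]
  have h1 : ∏ j ∈ Finset.univ.erase k, Real.cos ((n + Pi.single k 1 : Fin d → ℤ) j * θ j) =
      ∏ j ∈ Finset.univ.erase k, Real.cos (n j * θ j) :=
    Finset.prod_congr rfl fun j hj => by simp [hne hj]
  have h2 : ∏ j ∈ Finset.univ.erase k, Real.cos ((n - Pi.single k 1 : Fin d → ℤ) j * θ j) =
      ∏ j ∈ Finset.univ.erase k, Real.cos (n j * θ j) :=
    Finset.prod_congr rfl fun j hj => by simp [hne hj]
  rw [h1, h2]
  simp only [Pi.add_apply, Pi.sub_apply, Pi.single_eq_same, Int.cast_add, Int.cast_sub,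
    Int.cast_one, add_mul, sub_mul, one_mul, Real.cos_add, Real.cos_sub]
  ring

/-- The form `1 - x` allows an exponential bound that factors over coordinates. Absolute values are
needed because the symbol has modulus one also where all cosines are `-1`. -/
lemma abs_symbol_le (hd : 1 ≤ d) (θ : Fin d → ℝ) :
    |symbol θ| ≤ 1 - 1 / (d : ℝ) * ∑ k, (1 - |Real.cos (θ k)|) := by
  have hd' : (d : ℝ) ≠ 0 := by positivity
  have : 1 - 1 / (d : ℝ) * ∑ k, (1 - |Real.cos (θ k)|) =
      1 / (d : ℝ) * ∑ k, |Real.cos (θ k)| := by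
    rw [Finset.sum_sub_distrib]
    simp
    field_simp
    ring
  rw [this, symbol, abs_mul, abs_of_nonneg (by positivity : 0 ≤ 1 / (d : ℝ))]
  gcongr
  exact Finset.abs_sum_le_sum_abs _ _

lemma abs_prod_cos_le (n : Fin d → ℤ) (θ : Fin d → ℝ) :
    |∏ j, Real.cos (n j * θ j)| ≤ 1 := by
  rw [Finset.abs_prod]
  exact Finset.prod_le_one (fun _ _ => abs_nonneg _) fun _ _ => Real.abs_cos_le_one _

lemma continuous_symbol : Continuous (symbol (d := d)) := by
  unfold symbol
  fun_prop

lemma integrable_kernel (hd : 1 ≤ d) (t : ℕ) (n : Fin d → ℤ) :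
    Integrable (fun θ => symbol θ ^ t * ∏ j, Real.cos (n j * θ j)) (torusMeasure d) := by
  have hc : Continuous fun θ : Fin d → ℝ => symbol θ ^ t * ∏ j, Real.cos (n j * θ j) :=
    (continuous_symbol.pow t).mul (by fun_prop)
  refine Integrable.of_bound hc.aestronglyMeasurable 1 (Eventually.of_forall fun θ => ?_)
  rw [Real.norm_eq_abs, abs_mul, abs_pow]
  refine mul_le_one₀ (pow_le_one₀ (abs_nonneg _) ((abs_symbol_le hd θ).trans ?_)) (abs_nonneg _)
    (abs_prod_cos_le n θ)
  have : 0 ≤ ∑ k, (1 - |Real.cos (θ k)|) :=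
    Finset.sum_nonneg fun k _ => sub_nonneg.2 (Real.abs_cos_le_one _)
  rw [sub_le_self_iff]
  positivity

lemma avg_kernel (hd : 1 ≤ d) (t : ℕ) (n : Fin d → ℤ) :
    avg (kernel t) n = kernel (t + 1) n := by
  have hk (k : Fin d) : kernel t (n + Pi.single k 1) + kernel t (n - Pi.single k 1) =
      ((2 * Real.pi) ^ d)⁻¹ * ∫ θ, symbol θ ^ t * (2 * Real.cos (θ k) *
        ∏ j, Real.cos (n j * θ j)) ∂torusMeasure d := by
    rw [kernel, kernel, ← mul_add, ← integral_add (integrable_kernel hd t _)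
      (integrable_kernel hd t _)]
    simp only [← mul_add, prod_cos_add_sub]
  have hi (k : Fin d) : Integrable (fun θ => symbol θ ^ t * (2 * Real.cos (θ k) *
        ∏ j, Real.cos (n j * θ j))) (torusMeasure d) := by
    simp only [← prod_cos_add_sub, mul_add]
    exact (integrable_kernel hd t _).add (integrable_kernel hd t _)
  simp only [avg, hk]
  rw [← Finset.mul_sum, ← integral_finsetSum _ fun k _ => hi k, kernel, mul_left_comm,
    ← integral_const_mul]
  congr 2
  funext θ
  rw [pow_succ, ← Finset.mul_sum, ← Finset.sum_mul, ← Finset.mul_sum, symbol]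
  ring

lemma integral_cos_int_mul (m : ℤ) :
    ∫ x in Set.Ioc (-Real.pi) Real.pi, Real.cos (m * x) = if m = 0 then 2 * Real.pi else 0 := by
  rw [← intervalIntegral.integral_of_le (by linarith [Real.pi_pos])]
  split_ifs with h
  · simp [h]
    ring
  · have : (m : ℝ) ≠ 0 := by exact_mod_cast h
    rw [intervalIntegral.integral_comp_mul_left _ this, integral_cos]
    simp [Real.sin_int_mul_pi]

lemma kernel_zero (n : Fin d → ℤ) : kernel 0 n = if n = 0 then 1 else 0 := by
  have h : ∫ θ, ∏ j, Real.cos (n j * θ j) ∂torusMeasure d =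
      ∏ j, ∫ x in Set.Ioc (-Real.pi) Real.pi, Real.cos (n j * x) :=
    integral_fintype_prod_eq_prod fun j x => Real.cos (n j * x)
  simp only [kernel, pow_zero, one_mul, h, integral_cos_int_mul]
  split_ifs with hn
  · simp [hn, Real.pi_ne_zero]
  · obtain ⟨j, hj⟩ := Function.ne_iff.1 hn
    rw [Finset.prod_eq_zero (Finset.mem_univ j), mul_zero]
    exact if_neg hj

/-- Positivity is not visible in the Fourier integral; it comes from iterating averages of a point
mass. -/
lemma kernel_mem_Icc (hd : 1 ≤ d) (t : ℕ) (n : Fin d → ℤ) : kernel t n ∈ Set.Icc (0 : ℝ) 1 := by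
  induction t generalizing n with
  | zero => rw [kernel_zero]; split_ifs <;> simp
  | succ t ih =>
    rw [← avg_kernel hd]
    exact (avg_mem_and_map_le hd (convexOn_id (convex_Icc (0 : ℝ) 1)) ih n).1

lemma summable_mul_kernel (hd : 1 ≤ d) {a : (Fin d → ℤ) → ℝ} (ha : Summable fun n => |a n|)
    (t : ℕ) (n : Fin d → ℤ) : Summable fun m => a m * kernel t (n - m) := by
  refine Summable.of_norm_bounded ha fun m => ?_
  rw [Real.norm_eq_abs, abs_mul, abs_of_nonneg (kernel_mem_Icc hd t _).1]
  exact mul_le_of_le_one_right (abs_nonneg _) (kernel_mem_Icc hd t _).2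

lemma iterate_avg_eq_tsum (hd : 1 ≤ d) {a : (Fin d → ℤ) → ℝ} (ha : Summable fun n => |a n|)
    (t : ℕ) (n : Fin d → ℤ) : avg^[t] a n = ∑' m, a m * kernel t (n - m) := by
  induction t generalizing n with
  | zero =>
    rw [tsum_eq_single n fun m hm => by rw [kernel_zero, if_neg (sub_ne_zero.2 hm.symm), mul_zero]]
    simp [kernel_zero]
  | succ t ih =>
    rw [Function.iterate_succ_apply', avg_eq_sum]
    simp only [ih, ← avg_kernel hd]
    simp only [avg_eq_sum, Finset.mul_sum, ← tsum_mul_left, mul_left_comm (a _),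
      sub_add_eq_add_sub]
    exact (Summable.tsum_finsetSum fun i _ =>
      (summable_mul_kernel hd ha t (n + neighbour d i)).mul_left _).symm

/-- On the closed interval `|cos|` peaks at `0` and `±π`. Shifting `x` to the relevant peak, a
quadratic upper bound for cosine gives one of the three Gaussians. -/
lemma exp_neg_le_sum_gaussian {s x : ℝ} (hs : 0 ≤ s) (hx : x ∈ Set.Ioc (-Real.pi) Real.pi) :
    Real.exp (-s * (1 - |Real.cos x|)) ≤ Real.exp (-(2 / Real.pi ^ 2 * s) * x ^ 2) +
      Real.exp (-(2 / Real.pi ^ 2 * s) * (x - Real.pi) ^ 2) +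
      Real.exp (-(2 / Real.pi ^ 2 * s) * (x + Real.pi) ^ 2) := by
  have key {y : ℝ} (hy : |y| ≤ Real.pi) (h : |Real.cos x| = Real.cos y) :
      Real.exp (-s * (1 - |Real.cos x|)) ≤ Real.exp (-(2 / Real.pi ^ 2 * s) * y ^ 2) := by
    rw [Real.exp_le_exp, h]
    have := mul_le_mul_of_nonneg_left (Real.cos_le_one_sub_mul_cos_sq hy) hs
    linarith
  have e1 := Real.exp_pos (-(2 / Real.pi ^ 2 * s) * x ^ 2)
  have e2 := Real.exp_pos (-(2 / Real.pi ^ 2 * s) * (x - Real.pi) ^ 2)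
  have e3 := Real.exp_pos (-(2 / Real.pi ^ 2 * s) * (x + Real.pi) ^ 2)
  obtain ⟨h1, h2⟩ := hx
  rcases le_total 0 (Real.cos x) with hc | hc
  · linarith [key (abs_le.2 ⟨h1.le, h2⟩) (abs_of_nonneg hc)]
  · rcases le_total 0 x with h0 | h0
    · linarith [key (y := x - Real.pi) (abs_le.2 ⟨by linarith, by linarith⟩)
        (by rw [Real.cos_sub_pi, abs_of_nonpos hc])]
    · linarith [key (y := x + Real.pi) (abs_le.2 ⟨by linarith, by linarith⟩)
        (by rw [Real.cos_add_pi, abs_of_nonpos hc])]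

lemma integral_exp_neg_le {s : ℝ} (hs : 0 < s) :
    ∫ x in Set.Ioc (-Real.pi) Real.pi, Real.exp (-s * (1 - |Real.cos x|)) ≤
      3 * √(Real.pi / (2 / Real.pi ^ 2 * s)) := by
  have hb : 0 < 2 / Real.pi ^ 2 * s := by positivity
  have hg := integrable_exp_neg_mul_sq hb
  have hg1 := hg.comp_sub_right Real.pi
  have hg2 := hg.comp_add_right Real.pi
  have hg01 : Integrable fun x => Real.exp (-(2 / Real.pi ^ 2 * s) * x ^ 2) +
      Real.exp (-(2 / Real.pi ^ 2 * s) * (x - Real.pi) ^ 2) := hg.add hg1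
  calc ∫ x in Set.Ioc (-Real.pi) Real.pi, Real.exp (-s * (1 - |Real.cos x|))
      ≤ ∫ x in Set.Ioc (-Real.pi) Real.pi, (Real.exp (-(2 / Real.pi ^ 2 * s) * x ^ 2) +
          Real.exp (-(2 / Real.pi ^ 2 * s) * (x - Real.pi) ^ 2) +
          Real.exp (-(2 / Real.pi ^ 2 * s) * (x + Real.pi) ^ 2)) := by
        refine setIntegral_mono_on ?_ (hg01.add hg2).integrableOn measurableSet_Ioc
          fun x hx => exp_neg_le_sum_gaussian hs.le hx
        exact (Continuous.integrableOn_Icc (by fun_prop)).mono_set Set.Ioc_subset_Icc_self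
    _ ≤ ∫ x, (Real.exp (-(2 / Real.pi ^ 2 * s) * x ^ 2) +
          Real.exp (-(2 / Real.pi ^ 2 * s) * (x - Real.pi) ^ 2) +
          Real.exp (-(2 / Real.pi ^ 2 * s) * (x + Real.pi) ^ 2)) :=
        setIntegral_le_integral (hg01.add hg2) (Eventually.of_forall fun x => by positivity)
    _ = 3 * √(Real.pi / (2 / Real.pi ^ 2 * s)) := by
        rw [integral_add hg01 hg2, integral_add hg hg1,
          integral_sub_right_eq_self (fun x => Real.exp (-(2 / Real.pi ^ 2 * s) * x ^ 2)),
          integral_add_right_eq_self (fun x => Real.exp (-(2 / Real.pi ^ 2 * s) * x ^ 2)),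
          integral_gaussian]
        ring

lemma abs_kernel_integrand_le (hd : 1 ≤ d) (t : ℕ) (n : Fin d → ℤ) (θ : Fin d → ℝ) :
    |symbol θ ^ t * ∏ j, Real.cos (n j * θ j)| ≤
      ∏ j, Real.exp (-(t / d : ℝ) * (1 - |Real.cos (θ j)|)) := by
  have h : |symbol θ| ≤ Real.exp (-(1 / (d : ℝ) * ∑ k, (1 - |Real.cos (θ k)|))) :=
    (abs_symbol_le hd θ).trans (Real.one_sub_le_exp_neg _)
  rw [abs_mul, abs_pow, ← Real.exp_sum, ← Finset.mul_sum]
  calc |symbol θ| ^ t * |∏ j, Real.cos (n j * θ j)| ≤ |symbol θ| ^ t :=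
        mul_le_of_le_one_right (by positivity) (abs_prod_cos_le n θ)
    _ ≤ Real.exp (-(1 / (d : ℝ) * ∑ k, (1 - |Real.cos (θ k)|))) ^ t := by gcongr
    _ = _ := by
        rw [← Real.exp_nat_mul]
        ring_nf

/-- The on-diagonal heat kernel bound on the lattice. -/
lemma exists_kernel_le (hd : 1 ≤ d) : ∃ K : ℝ, 0 < K ∧ ∀ t : ℕ, 1 ≤ t → ∀ n : Fin d → ℤ,
    kernel t n ≤ K * (t : ℝ) ^ (-(d / 2 : ℝ)) := by
  have hd' : (0 : ℝ) < d := by exact_mod_cast hd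
  refine ⟨((2 * Real.pi) ^ d)⁻¹ * (3 * √(Real.pi ^ 3 * d / 2)) ^ d, by positivity,
    fun t ht n => ?_⟩
  have ht' : (0 : ℝ) < t := by exact_mod_cast ht
  have hs : (0 : ℝ) < t / d := by positivity
  have hint : Integrable (fun θ : Fin d → ℝ =>
      ∏ j, Real.exp (-(t / d : ℝ) * (1 - |Real.cos (θ j)|))) (torusMeasure d) := by
    refine Integrable.fintype_prod
      (f := fun _ x => Real.exp (-(t / d : ℝ) * (1 - |Real.cos x|))) fun j => ?_
    exact (Continuous.integrableOn_Icc (by fun_prop)).mono_set Set.Ioc_subset_Icc_self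
  have h1 : ∫ θ, symbol θ ^ t * ∏ j, Real.cos (n j * θ j) ∂torusMeasure d ≤
      (3 * √(Real.pi / (2 / Real.pi ^ 2 * (t / d)))) ^ d := by
    calc ∫ θ, symbol θ ^ t * ∏ j, Real.cos (n j * θ j) ∂torusMeasure d
        ≤ ∫ θ, ∏ j, Real.exp (-(t / d : ℝ) * (1 - |Real.cos (θ j)|)) ∂torusMeasure d :=
          integral_mono (integrable_kernel hd t n) hint fun θ =>
            (le_abs_self _).trans (abs_kernel_integrand_le hd t n θ)
      _ = (∫ x in Set.Ioc (-Real.pi) Real.pi, Real.exp (-(t / d : ℝ) * (1 - |Real.cos x|))) ^ d := by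
          rw [torusMeasure, integral_fintype_prod_eq_pow
            fun x : ℝ => Real.exp (-(t / d : ℝ) * (1 - |Real.cos x|)), Fintype.card_fin]
      _ ≤ _ := by
          gcongr
          exact integral_exp_neg_le hs
  have h2 : √(Real.pi / (2 / Real.pi ^ 2 * (t / d))) =
      √(Real.pi ^ 3 * d / 2) * (t : ℝ) ^ (-(1 / 2) : ℝ) := by
    rw [Real.rpow_neg ht'.le, ← Real.sqrt_eq_rpow, ← div_eq_mul_inv, ← Real.sqrt_div (by positivity)]
    congr 1
    field_simp
  have h3 : ((t : ℝ) ^ (-(1 / 2) : ℝ)) ^ d = (t : ℝ) ^ (-(d / 2 : ℝ)) := by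
    rw [← Real.rpow_natCast, ← Real.rpow_mul ht'.le]
    ring_nf
  rw [kernel, mul_assoc]
  gcongr
  rwa [h2, ← mul_assoc, mul_pow, h3] at h1

lemma exists_iterate_avg_le (hd : 1 ≤ d) : ∃ K : ℝ, 0 < K ∧ ∀ a : (Fin d → ℤ) → ℝ,
    Summable (fun n => |a n|) → ∀ t : ℕ, 1 ≤ t → ∀ n : Fin d → ℤ,
      avg^[t] a n ≤ K * (t : ℝ) ^ (-(d / 2 : ℝ)) * ∑' m, |a m| := by
  obtain ⟨K, hK, h⟩ := exists_kernel_le hd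
  refine ⟨K, hK, fun a ha t ht n => ?_⟩
  rw [iterate_avg_eq_tsum hd ha, ← tsum_mul_left]
  refine (summable_mul_kernel hd ha t n).tsum_le_tsum (fun m => ?_) (ha.mul_left _)
  rw [mul_comm]
  have h0 := (kernel_mem_Icc hd t (n - m)).1
  calc kernel t (n - m) * a m ≤ kernel t (n - m) * |a m| := by gcongr; exact le_abs_self _
    _ ≤ _ := by gcongr; exact h t ht _

/-! ### Global existence for small data -/

/-- The sequence defined by the recursion, whether or not it is a global solution. -/
noncomputable def evolution (α : ℝ) (a : (Fin d → ℤ) → ℝ) : ℕ → (Fin d → ℤ) → ℝ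
  | 0 => a
  | τ + 1 => fun n => growth α 1 (avg (evolution α a τ) n)

lemma IsGlobalSolution.eq_evolution {a : (Fin d → ℤ) → ℝ} {f : ℕ → (Fin d → ℤ) → ℝ}
    (hf : IsGlobalSolution α a f) : f = evolution α a := by
  funext τ
  induction τ with
  | zero => exact funext hf.initial
  | succ τ ih =>
    funext n
    rw [hf.step_eq_growth, ih, evolution]

/-- One step of the recursion maps a multiple of a solution of the linear equation below another
multiple of it. -/
lemma growth_one_le {μ m u g : ℝ} (hα : 0 < α) (hm : 0 ≤ m) (hμ : 0 < μ - m) (hu : 0 ≤ u)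
    (hum : u ^ α ≤ m) (hg : 0 ≤ g) (hgu : g ≤ u / μ ^ (1 / α)) :
    g < 1 ∧ growth α 1 g ≤ u / (μ - m) ^ (1 / α) := by
  have hμ0 : 0 < μ := by linarith
  have hv : (u / μ ^ (1 / α)) ^ α = u ^ α / μ := by
    rw [Real.div_rpow hu (Real.rpow_nonneg hμ0.le _), ← Real.rpow_mul hμ0.le,
      one_div_mul_cancel hα.ne', Real.rpow_one]
  have hv0 : 0 ≤ u / μ ^ (1 / α) := by positivity
  have hv1 : (u / μ ^ (1 / α)) ^ α < 1 := by
    rw [hv, div_lt_one hμ0]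
    linarith
  refine ⟨hgu.trans_lt ?_, ?_⟩
  · by_contra! h
    exact hv1.not_ge (Real.one_le_rpow h hα.le)
  refine (growth_mono hα zero_le_one hg ⟨hv0, by linarith⟩ hgu).trans ?_
  have h1 : 0 < 1 - 1 * (u ^ α / μ) := by rw [← hv]; linarith
  rw [growth, hv, div_div, ← Real.mul_rpow hμ0.le h1.le,
    show μ * (1 - 1 * (u ^ α / μ)) = μ - u ^ α by field_simp]
  gcongr

/-- The supersolution is `avg^[k] a` divided by the `1/α`-th power of `1 - ∑ j < k, m j`: each step
uses up `m k` of this budget, and `hμ` says that it never runs out. -/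
lemma isGlobalSolution_evolution {a : (Fin d → ℤ) → ℝ} (hα : 0 < α) (ha : ∀ n, 0 ≤ a n)
    {m : ℕ → ℝ} (hm : ∀ k n, avg^[k + 1] a n ^ α ≤ m k)
    (hμ : ∀ k, 0 < 1 - ∑ j ∈ Finset.range k, m j) : IsGlobalSolution α a (evolution α a) := by
  have hm0 (k : ℕ) : 0 ≤ m k :=
    (Real.rpow_nonneg (iterate_avg_nonneg ha (k + 1) 0) α).trans (hm k 0)
  have step (k : ℕ) (h : ∀ n, 0 ≤ evolution α a k n ∧
      evolution α a k n ≤ avg^[k] a n / (1 - ∑ j ∈ Finset.range k, m j) ^ (1 / α))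
      (n : Fin d → ℤ) : avg (evolution α a k) n < 1 ∧ evolution α a (k + 1) n ≤
        avg^[k + 1] a n / (1 - ∑ j ∈ Finset.range (k + 1), m j) ^ (1 / α) := by
    have hμ' := hμ (k + 1)
    rw [Finset.sum_range_succ, ← sub_sub] at hμ' ⊢
    refine growth_one_le hα (hm0 k) hμ' (iterate_avg_nonneg ha (k + 1) n) (hm k n)
      (avg_nonneg (fun n => (h n).1) n) ((avg_mono (fun n => (h n).2) n).trans_eq ?_)
    simp only [div_eq_inv_mul]
    rw [avg_const_mul, Function.iterate_succ_apply']
  have key (k : ℕ) : ∀ n, 0 ≤ evolution α a k n ∧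
      evolution α a k n ≤ avg^[k] a n / (1 - ∑ j ∈ Finset.range k, m j) ^ (1 / α) := by
    induction k with
    | zero => exact fun n => ⟨ha n, by simp [evolution]⟩
    | succ k ih =>
      intro n
      have hg := avg_nonneg (fun n => (ih n).1) n
      refine ⟨growth_nonneg ⟨hg, ?_⟩, (step k ih n).2⟩
      rw [one_mul]
      exact Real.rpow_lt_one hg (step k ih n).1 hα
  refine ⟨fun n => rfl, fun τ n => (key τ n).1, fun k n => (step k (key k) n).1, fun τ n => ?_⟩
  change growth α 1 _ = _
  rw [growth, one_mul]

theorem exists_forall_isGlobalSolution (hd : 1 ≤ d) (hα : 0 < α) (h : 2 / (d : ℝ) < α) :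
    ∃ ε : ℝ, 0 < ε ∧ ∀ a : (Fin d → ℤ) → ℝ, (∀ n, 0 ≤ a n) → Summable (fun n => |a n|) →
      ∑' n, |a n| < ε → IsGlobalSolution α a (evolution α a) := by
  obtain ⟨K, hK, hbound⟩ := exists_iterate_avg_le hd
  have hd' : (0 : ℝ) < d := by exact_mod_cast hd
  have hexp : -(d / 2 : ℝ) * α < -1 := by
    rw [div_lt_iff₀ hd'] at h
    linarith
  have hsum : Summable fun j : ℕ => K ^ α * ((j + 1 : ℕ) : ℝ) ^ (-(d / 2 : ℝ) * α) :=
    (((summable_nat_add_iff 1).2 (Real.summable_nat_rpow.2 hexp))).mul_left _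
  set S := ∑' j : ℕ, K ^ α * ((j + 1 : ℕ) : ℝ) ^ (-(d / 2 : ℝ) * α) with hS
  have hS0 : 0 ≤ S := tsum_nonneg fun j => by positivity
  -- Chosen so that the `α`-th power of the norm times `S` stays below one, the total budget.
  refine ⟨(1 / (S + 1)) ^ (1 / α), by positivity, fun a ha has hlt => ?_⟩
  have hA : 0 ≤ ∑' n, |a n| := tsum_nonneg fun n => abs_nonneg _
  have hAα : (∑' n, |a n|) ^ α * (S + 1) < 1 := by
    have := Real.rpow_lt_rpow hA hlt hα
    rwa [← Real.rpow_mul (by positivity), one_div_mul_cancel hα.ne', Real.rpow_one,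
      lt_div_iff₀ (by positivity)] at this
  refine isGlobalSolution_evolution hα ha (m := fun j =>
    K ^ α * ((j + 1 : ℕ) : ℝ) ^ (-(d / 2 : ℝ) * α) * (∑' n, |a n|) ^ α) (fun k n => ?_)
    fun k => ?_
  · refine (Real.rpow_le_rpow (iterate_avg_nonneg ha _ n) (hbound a has (k + 1) (by omega) n)
      hα.le).trans_eq ?_
    rw [Real.mul_rpow (by positivity) hA, Real.mul_rpow hK.le (by positivity),
      ← Real.rpow_mul (by positivity)]
  · rw [← Finset.sum_mul]
    have h1 := hsum.sum_le_tsum (Finset.range k) fun j _ => by positivity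
    have h2 : 0 ≤ (∑' n, |a n|) ^ α := Real.rpow_nonneg hA _
    have h3 := mul_le_mul_of_nonneg_right h1 h2
    rw [← hS] at h3
    linarith

end DiscreteHeat


theorem theorem2p1 (d : ℕ) (hd : 1 ≤ d) (α : ℝ) (hα : 0 < α) :
    (α < 2 / (d : ℝ) →
      ∀ a : (Fin d → ℤ) → ℝ, DiscreteHeat.IsInitialDatum a →
        ¬ ∃ f : ℕ → (Fin d → ℤ) → ℝ, DiscreteHeat.IsGlobalSolution α a f) ∧
    (α = 2 / (d : ℝ) →
      ∀ a : (Fin d → ℤ) → ℝ, DiscreteHeat.IsInitialDatum a →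
        ¬ ∃ f : ℕ → (Fin d → ℤ) → ℝ, DiscreteHeat.IsGlobalSolution α a f) ∧
    (2 / (d : ℝ) < α →
      ∃ ε : ℝ, 0 < ε ∧
        ∀ a : (Fin d → ℤ) → ℝ, DiscreteHeat.IsInitialDatum a →
          Summable (fun n => |a n|) → ∑' n, |a n| < ε →
            ∃! f : ℕ → (Fin d → ℤ) → ℝ, DiscreteHeat.IsGlobalSolution α a f) := by
  refine ⟨fun h a ha ⟨f, hf⟩ => hf.false_of_subcritical hd hα ha h,
    fun h a ha ⟨f, hf⟩ => hf.false_of_critical hd hα ha h, fun h => ?_⟩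
  obtain ⟨ε, hε, H⟩ := DiscreteHeat.exists_forall_isGlobalSolution hd hα h
  exact ⟨ε, hε, fun a ha has hlt => ⟨DiscreteHeat.evolution α a, H a ha.nonneg has hlt,
    fun f hf => hf.eq_evolution⟩⟩
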